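/- Let $E$ be a set with a total order $<$, and let $I\subseteq E\times E$ be an independence relation, i.e. an irreflexive and symmetric relation. Let $M(E,I)$ be the trace monoid, i.e. the quotient of the free monoid $E^*$ by the congruence generated by $ab\equiv ba$ for $(a,b)\in I$. Let $S$ be a set with a partial right action of $M(E,I)$: to every $w\in M(E,I)$ there corresponds a partial map $s\mapsto s\cdot w$ of $S$ to itself such that $s\cdot 1=s$ and $s\cdot(vw)=(s\cdot v)\cdot w$ (one side being defined if and only if the other is). Put $S_*=S\sqcup\{*\}$ and extend the action to a total action of $M(E,I)$ on $S_*$ by $s\cdot w=*$ if $s\cdot w$ is not defined, and $*\cdot w=*$. The augmented state category $K_*(S)$ has $S_*$ as its set of objects; its morphisms $x\to x'$ are the triples $(x,w,x')$ with $w\in M(E,I)$ and $x\cdot w=x'$, and the composite of $(x,w,x')$ followed by $(x',w',x'')$ is $(x,ww',x'')$. For a small category $\mathcal C$ and a functor $F:\mathcal C\to \mathrm{Ab}$, let $H_n(\mathcal C,F)$ be the $n$-th homology group of the chain complex with terms $\bigoplus_{c_0\to\cdots\to c_n}F(c_0)$ and differentials $\sum_{i=0}^n(-1)^id_i$, where $d_i$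 omits $c_i$ from the chain $c_0\to\cdots\to c_n$ (composing the two adjacent arrows if $0<i<n$), with the homomorphism $F(c_0\to c_1)$ on coefficients if $i=0$ and the identity if $i>0$. For $n\ge 0$ let $Q_n(E,I,S)$ be the set of all $(x,a_1,\dots,a_n)$ with $x\in S_*$ and $a_1,\dots,a_n\in E$ such that $a_i<a_j$ and $(a_i,a_j)\in I$ for all $1\le i<j\le n$; in particular $Q_0(E,I,S)=S_*$. **Theorem.** Suppose that $E$ contains no infinite subset of pairwise independent generators, i.e. no infinite $B\subseteq E$ such that $(a,b)\in I$ for all distinct $a,b\in B$. Then for every functor $F:K_*(S)\to\mathrm{Ab}$ and every $n\ge 0$ the group $H_n(K_*(S),F)$ is isomorphic to the $n$-th homology group of the chain complex $$0\leftarrow \bigoplus_{x\in S_*}F(x)\xleftarrow{d_1}\bigoplus_{(x,a_1)\in Q_1(E,I,S)}F(x)\xleftarrow{d_2}\bigoplus_{(x,a_1,a_2)\in Q_2(E,I,S)}F(x)\leftarrow\cdots\xleftarrow{d_n}\bigoplus_{(x,a_1,\dots,a_n)\in Q_n(E,I,S)}F(x)\leftarrow\cdots$$ with the differentials, for $f\in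 F(x)$, $$d_n(x,a_1,\dots,a_n,f)=\sum_{s=1}^n(-1)^s\Bigl(\bigl(x\cdot a_s,a_1,\dots,\widehat{a_s},\dots,a_n,F(x\xrightarrow{a_s}x\cdot a_s)(f)\bigr)-\bigl(x,a_1,\dots,\widehat{a_s},\dots,a_n,f\bigr)\Bigr).$$ -/

import Mathlib

open CategoryTheory Opposite DirectSum

universe u v w t

noncomputable section

namespace TraceHomology

/-! ### Direct sums of the values of a functor -/

section DirectSums

variable {C : Type u} [Category.{v} C] {ι : Type t} (F : C ⥤ AddCommGrpCat.{w}) (p : ι → C)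

/-- The abelian group `⨁ i, F (p i)` for a family `p` of objects. -/
abbrev FSum : Type (max t w) := ⨁ i, F.obj (p i)

open Classical in
/-- For an arrow `f : x ⟶ p i`, the homomorphism `F x → ⨁ i, F (p i)`, `a ↦ (i, F(f)(a))`. -/
def push {x : C} (i : ι) (f : x ⟶ p i) : F.obj x →+ FSum F p :=
  (DirectSum.of (fun i => F.obj (p i)) i).comp (F.map f).hom

open Classical in
/-- The homomorphism out of `⨁ i, F (p i)` with prescribed restrictions to the summands. -/
def glue {A : Type*} [AddCommGroup A] (φ : ∀ i, F.obj (p i) →+ A) : FSum F p →+ A :=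
  DirectSum.toAddMonoid φ

open Classical in
lemma glue_push {A : Type*} [AddCommGroup A] (φ : ∀ i, F.obj (p i) →+ A) {x : C} (i : ι)
    (f : x ⟶ p i) (a : F.obj x) : glue F p φ (push F p i f a) = φ i (F.map f a) := by
  simp [glue, push]

lemma push_map {x y : C} (i : ι) (f : x ⟶ y) (g : y ⟶ p i) (a : F.obj x) :
    push F p i g (F.map f a) = push F p i (f ≫ g) a := by
  simp [push]

lemma push_congr {x : C} {i j : ι} (h : i = j) (f : x ⟶ p i) (g : x ⟶ p j)
    (hfg : f ≫ eqToHom (congrArg p h) = g) : push F p i f = push F p j g := by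
  subst h
  simp only [eqToHom_refl, Category.comp_id] at hfg
  rw [hfg]

variable {F p} in
open Classical in
lemma hom_ext {A : Type*} [AddCommGroup A] {φ ψ : FSum F p →+ A}
    (h : ∀ i a, φ (push F p i (𝟙 _) a) = ψ (push F p i (𝟙 _) a)) : φ = ψ := by
  refine DirectSum.addHom_ext fun i a => ?_
  simpa [push] using h i a

end DirectSums

/-! ### Homology of a small category with coefficients in a functor -/

section SmallCategory

variable {C : Type u} [Category.{v} C] (F : C ⥤ AddCommGrpCat.{w})

/-- The first object `c₀` of a simplex `c₀ ⟶ ⋯ ⟶ cₙ` of the nerve. -/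
abbrev firstObj {Δ : SimplexCategoryᵒᵖ} (σ : (nerve C).obj Δ) : C :=
  ComposableArrows.obj' σ 0

/-- The arrow `c₀ ⟶ c_{φ(0)}` from the first object of `σ` to the first object of `φ^*σ`. -/
def firstMap {Δ Δ' : SimplexCategoryᵒᵖ} (φ : Δ ⟶ Δ') (σ : (nerve C).obj Δ) :
    firstObj σ ⟶ firstObj ((nerve C).map φ σ) :=
  ComposableArrows.map' σ 0 (φ.unop.toOrderHom 0).1 (Nat.zero_le _)
    (Nat.le_of_lt_succ (φ.unop.toOrderHom 0).2)

lemma firstMap_id {Δ : SimplexCategoryᵒᵖ} (σ : (nerve C).obj Δ) (h) :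
    firstMap (𝟙 Δ) σ ≫ eqToHom h = 𝟙 (firstObj σ) := by
  exact (Category.comp_id (firstMap (𝟙 Δ) σ)).trans (ComposableArrows.map'_self σ 0)

lemma firstMap_comp {Δ Δ' Δ'' : SimplexCategoryᵒᵖ} (φ : Δ ⟶ Δ') (ψ : Δ' ⟶ Δ'')
    (σ : (nerve C).obj Δ) (h) :
    firstMap (φ ≫ ψ) σ ≫ eqToHom h = firstMap φ σ ≫ firstMap ψ ((nerve C).map φ σ) := by
  exact (Category.comp_id (firstMap (φ ≫ ψ) σ)).trans
    (ComposableArrows.map'_comp σ 0 (φ.unop.toOrderHom 0).1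
      (φ.unop.toOrderHom (ψ.unop.toOrderHom 0)).1 (Nat.zero_le _)
      (φ.unop.toOrderHom.monotone (Fin.zero_le _)) (Nat.le_of_lt_succ (Fin.is_lt _)))

/-- The simplicial abelian group `[n] ↦ ⨁_{c₀ ⟶ ⋯ ⟶ cₙ} F(c₀)`. A simplicial operator `φ` sends
`(σ, a)` to `(φ^*σ, F(c₀ ⟶ c_{φ(0)})(a))`. -/
def simplicialReplacement : SimplicialObject AddCommGrpCat.{max u v w} where
  obj Δ := .of (FSum F (fun σ : (nerve C).obj Δ => firstObj σ))
  map φ := AddCommGrpCat.ofHom (glue F _ fun σ =>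
    push F (fun τ => firstObj τ) ((nerve C).map φ σ) (firstMap φ σ))
  map_id Δ := by
    refine AddCommGrpCat.hom_ext (hom_ext fun σ a => ?_)
    simp only [AddCommGrpCat.hom_id, AddCommGrpCat.hom_ofHom, AddMonoidHom.id_apply, glue_push]
    simp only [push_map]
    refine DFunLike.congr_fun (push_congr F _ ?_ _ _ ?_) a
    · rfl
    · simp only [Category.id_comp]
      exact firstMap_id σ _
  map_comp φ ψ := by
    refine AddCommGrpCat.hom_ext (hom_ext fun σ a => ?_)
    simp only [AddCommGrpCat.hom_comp, AddCommGrpCat.hom_ofHom, AddMonoidHom.comp_apply, glue_push]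
    simp only [push_map]
    refine DFunLike.congr_fun (push_congr F _ ?_ _ _ ?_) a
    · rfl
    · simp only [Category.id_comp]
      exact firstMap_comp φ ψ σ _

/-- The chain complex with `n`-th term `⨁_{c₀ ⟶ ⋯ ⟶ cₙ} F(c₀)` and with differential
`∑ᵢ (-1)ⁱ dᵢ`, where `dᵢ` omits `cᵢ` (composing the two adjacent arrows if `0 < i < n`) and is
induced on coefficients by `F(c₀ ⟶ c₁)` for `i = 0` and by the identity for `i > 0`. -/
def categoryComplex : ChainComplex AddCommGrpCat.{max u v w} ℕ :=
  (AlgebraicTopology.alternatingFaceMapComplex _).obj (simplicialReplacement F)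

/-- The homology group `Hₙ(C, F)` of the small category `C` with coefficients in `F`. -/
def categoryHomology (n : ℕ) : AddCommGrpCat.{max u v w} := (categoryComplex F).homology n

end SmallCategory

/-! ### Trace monoids and state spaces -/

section Trace

variable {E : Type u}

/-- Independence relations: irreflexive and symmetric relations. -/
structure IsIndependence (I : E → E → Prop) : Prop where
  irrefl : ∀ a, ¬ I a a
  symm : ∀ a b, I a b → I b a

/-- The defining relations `ab = ba`, for `(a, b) ∈ I`, of the trace monoid. -/
inductive TraceRel (I : E → E → Prop) : FreeMonoid E → FreeMonoid E → Prop
  | swap (a b : E) (_ : I a b) :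
      TraceRel I (FreeMonoid.of a * FreeMonoid.of b) (FreeMonoid.of b * FreeMonoid.of a)

/-- The trace monoid `M(E, I)`: the quotient of the free monoid by the congruence generated by
`ab ≡ ba` for `(a, b) ∈ I`. -/
abbrev TraceMonoid (I : E → E → Prop) : Type u := PresentedMonoid (TraceRel I)

/-- The class of a generator in `M(E, I)`. -/
abbrev gen (I : E → E → Prop) (a : E) : TraceMonoid I := PresentedMonoid.of (TraceRel I) a

lemma gen_comm {I : E → E → Prop} {a b : E} (h : I a b) :
    gen I a * gen I b = gen I b * gen I a :=
  PresentedMonoid.mk_eq_mk_of_rel (TraceRel.swap a b h)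

/-- A partial right action of a monoid `M` on a set `S`, that is, a functor from `Mᵒᵖ` to sets and
partial maps with value `S`; `act s w = none` means that `s · w` is undefined. -/
structure PartialAction (M : Type u) [Monoid M] (S : Type v) where
  act : S → M → Option S
  act_one : ∀ s, act s 1 = some s
  act_mul : ∀ s μ ν, act s (μ * ν) = (act s μ).bind fun s' => act s' ν

variable {M : Type u} [Monoid M] {S : Type v}

/-- The set of objects `S_* = S ⊔ {*}` of the augmented state category; `none` is the added
state `*`. -/
def AugState (_A : PartialAction M S) : Type v := Option S

/-- The total action on `S_*`: `s · w = *` if `s · w` is undefined, and `* · w = *`. -/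
def PartialAction.aug (A : PartialAction M S) (x : AugState A) (μ : M) : AugState A :=
  Option.bind x fun s => A.act s μ

lemma PartialAction.aug_one (A : PartialAction M S) (x : AugState A) : A.aug x 1 = x := by
  cases x with
  | none => rfl
  | some s => exact A.act_one s

lemma PartialAction.aug_mul (A : PartialAction M S) (x : AugState A) (μ ν : M) :
    A.aug x (μ * ν) = A.aug (A.aug x μ) ν := by
  cases x with
  | none => rfl
  | some s => exact A.act_mul s μ ν

/-- The augmented state category `K_*(S)`: the morphisms `x ⟶ y` are the `w ∈ M` such that
`x · w = y`, and the composition of `w : x ⟶ y` and `w' : y ⟶ z` is `w w' : x ⟶ z`. -/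
instance augStateCategory (A : PartialAction M S) : Category.{u} (AugState A) where
  Hom x y := {μ : M // A.aug x μ = y}
  id x := ⟨1, A.aug_one x⟩
  comp f g := ⟨f.1 * g.1, by rw [A.aug_mul, f.2, g.2]⟩
  id_comp f := Subtype.ext (one_mul f.1)
  comp_id f := Subtype.ext (mul_one f.1)
  assoc f g h := Subtype.ext (mul_assoc f.1 g.1 h.1)

/-- The morphism `x ⟶ x · w` of the augmented state category given by `w`. -/
def step (A : PartialAction M S) (x : AugState A) (μ : M) : x ⟶ A.aug x μ := ⟨μ, rfl⟩

lemma comp_val (A : PartialAction M S) {x y z : AugState A} (f : x ⟶ y) (g : y ⟶ z) :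
    (f ≫ g).1 = f.1 * g.1 := rfl

lemma id_val (A : PartialAction M S) (x : AugState A) : (𝟙 x : x ⟶ x).1 = 1 := rfl

lemma eqToHom_val (A : PartialAction M S) {x y : AugState A} (h : x = y) :
    (eqToHom h).1 = 1 := by
  subst h; rfl

end Trace

/-! ### The cubical complex of a state space -/

section Cubes

variable {E : Type u} {I : E → E → Prop} [LinearOrder E] {S : Type v}

variable (I) in
/-- `Tₙ(E, I)`: the sequences `a₁ < ⋯ < aₙ` of pairwise independent generators. -/
def Torus (n : ℕ) : Type u :=
  {a : Fin n → E // ∀ i j, i < j → a i < a j ∧ I (a i) (a j)}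

/-- Omitting the entry with index `s`. -/
def Torus.erase {n : ℕ} (a : Torus I (n + 1)) (s : Fin (n + 1)) : Torus I n :=
  ⟨fun i => a.1 (s.succAbove i), fun _ _ h => a.2 _ _ (Fin.succAbove_lt_succAbove_iff.2 h)⟩

/-- The set `Qₙ(E, I, S) = S_* × Tₙ(E, I)` of the cubes `(x, a₁, …, aₙ)`. -/
@[ext]
structure Cube (A : PartialAction (TraceMonoid I) S) (n : ℕ) : Type (max u v) where
  base : AugState A
  dirs : Torus I n

variable {A : PartialAction (TraceMonoid I) S} (F : AugState A ⥤ AddCommGrpCat.{w})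

/-- The face `(x, a₁, …, âₛ, …, aₙ)`. -/
abbrev Cube.face₀ {n : ℕ} (q : Cube A (n + 1)) (s : Fin (n + 1)) : Cube A n :=
  ⟨q.base, q.dirs.erase s⟩

/-- The face `(x · aₛ, a₁, …, âₛ, …, aₙ)`. -/
abbrev Cube.face₁ {n : ℕ} (q : Cube A (n + 1)) (s : Fin (n + 1)) : Cube A n :=
  ⟨A.aug q.base (gen I (q.dirs.1 s)), q.dirs.erase s⟩

/-- The group `⨁_{(x, a₁, …, aₙ) ∈ Qₙ(E, I, S)} F(x)`. -/
abbrev CubeChains (n : ℕ) : Type (max u v w) := FSum F (Cube.base (A := A) (n := n))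

/-- The homomorphism
`(x, a₁, …, aₙ, f) ↦ (x·aₛ, a₁, …, âₛ, …, aₙ, F(x ⟶ x·aₛ)(f)) - (x, a₁, …, âₛ, …, aₙ, f)`. -/
def cubeFace (n : ℕ) (s : Fin (n + 1)) : CubeChains F (n + 1) →+ CubeChains F n :=
  glue F Cube.base fun q =>
    push F Cube.base (q.face₁ s) (step A q.base (gen I (q.dirs.1 s))) -
      push F Cube.base (q.face₀ s) (𝟙 q.base)

/-- The differential `∑ₛ (-1)ˢ cubeFace s`, `1 ≤ s ≤ n + 1`; the index `s : Fin (n + 1)` used here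
starts from `0`. -/
def cubeD (n : ℕ) : CubeChains F (n + 1) →+ CubeChains F n :=
  ∑ s : Fin (n + 1), (-1 : ℤ) ^ ((s : ℕ) + 1) • cubeFace F n s

lemma cubeFace_push {n : ℕ} (s : Fin (n + 1)) {x : AugState A} (q : Cube A (n + 1))
    (f : x ⟶ q.base) (a : F.obj x) :
    cubeFace F n s (push F Cube.base q f a) =
      push F Cube.base (q.face₁ s) (f ≫ step A q.base (gen I (q.dirs.1 s))) a -
        push F Cube.base (q.face₀ s) (f ≫ 𝟙 q.base) a := by
  rw [cubeFace, glue_push, AddMonoidHom.sub_apply, push_map, push_map]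

lemma push_cube_congr {n : ℕ} {x : AugState A} {q r : Cube A n} (f : x ⟶ q.base) (g : x ⟶ r.base)
    (hfg : f.1 = g.1) (hd : q.dirs = r.dirs) :
    push F Cube.base q f = push F Cube.base r g := by
  have hb : q.base = r.base := by rw [← f.2, ← g.2, hfg]
  refine push_congr F Cube.base (Cube.ext hb hd) f g (Subtype.ext ?_)
  rw [comp_val, eqToHom_val, mul_one, hfg]

lemma succAbove_comm {n : ℕ} {i j : Fin (n + 1)} (h : i ≤ j) (k : Fin n) :
    j.succ.succAbove (i.succAbove k) = i.castSucc.succAbove (j.succAbove k) := by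
  simp only [Fin.ext_iff, Fin.succAbove, Fin.lt_def, Fin.le_def] at *
  split_ifs <;> simp at * <;> omega

lemma Torus.erase_erase {n : ℕ} (a : Torus I (n + 2)) {i j : Fin (n + 1)} (h : i ≤ j) :
    (a.erase j.succ).erase i = (a.erase i.castSucc).erase j :=
  Subtype.ext (funext fun k => congrArg a.1 (succAbove_comm h k))

lemma cubeFace_comm (n : ℕ) (i j : Fin (n + 1)) (h : i ≤ j) (c : CubeChains F (n + 2)) :
    cubeFace F n i (cubeFace F (n + 1) j.succ c) =
      cubeFace F n j (cubeFace F (n + 1) i.castSucc c) := by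
  refine DFunLike.congr_fun (f := (cubeFace F n i).comp (cubeFace F (n + 1) j.succ))
    (g := (cubeFace F n j).comp (cubeFace F (n + 1) i.castSucc)) (hom_ext fun q a => ?_) c
  have h1 : (q.dirs.erase j.succ).1 i = q.dirs.1 i.castSucc :=
    congrArg q.dirs.1 (Fin.succAbove_of_castSucc_lt _ _ (Fin.castSucc_lt_succ_iff.2 h))
  have h2 : (q.dirs.erase i.castSucc).1 j = q.dirs.1 j.succ :=
    congrArg q.dirs.1 (Fin.succAbove_of_le_castSucc _ _ (Fin.castSucc_le_castSucc_iff.2 h))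
  have h3 : I (q.dirs.1 i.castSucc) (q.dirs.1 j.succ) :=
    (q.dirs.2 _ _ (Fin.castSucc_lt_succ_iff.2 h)).2
  have ho := Torus.erase_erase q.dirs h
  simp only [AddMonoidHom.comp_apply, cubeFace_push, map_sub]
  rw [sub_sub_sub_comm]
  congr 2 <;> refine DFunLike.congr_fun (push_cube_congr F _ _ ?_ ho) a <;>
    simp only [comp_val, id_val, one_mul, mul_one, step, h1, h2]
  exact (gen_comm h3).symm

lemma cubeD_squared (n : ℕ) : (cubeD F n).comp (cubeD F (n + 1)) = 0 := by
  refine AddMonoidHom.ext fun a => ?_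
  simp only [cubeD, AddMonoidHom.comp_apply, AddMonoidHom.finsetSum_apply, map_sum,
    AddMonoidHom.zsmul_apply, map_zsmul, AddMonoidHom.zero_apply]
  simp only [Finset.smul_sum, smul_smul, ← Finset.sum_product']
  let P := Fin (n + 2) × Fin (n + 1)
  let T : Finset P := {ij : P | (ij.1 : ℕ) ≤ (ij.2 : ℕ)}
  rw [Finset.univ_product_univ, ← Finset.sum_add_sum_compl T, ← eq_neg_iff_add_eq_zero,
    ← Finset.sum_neg_distrib]
  let φ : ∀ ij : P, ij ∈ T → P := fun ij hij =>
    (ij.2.succ, ij.1.castLT (lt_of_le_of_lt (Finset.mem_filter.mp hij).right (Fin.is_lt ij.2)))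
  apply Finset.sum_bij φ
  · intro ij hij
    simp_rw [T, φ, Finset.compl_filter, Finset.mem_filter_univ, Fin.val_succ,
      Fin.val_castLT] at hij ⊢
    lia
  · rintro ⟨i, j⟩ hij ⟨i', j'⟩ hij' h
    have h1 := congrArg (fun x : P => (x.1 : ℕ)) h
    have h2 := congrArg (fun x : P => (x.2 : ℕ)) h
    simp only [φ, Fin.val_succ, Fin.val_castLT] at h1 h2
    exact Prod.ext (Fin.ext h2) (Fin.ext (by simpa using h1))
  · rintro ⟨i', j'⟩ hij'
    simp_rw [T, Finset.compl_filter, Finset.mem_filter_univ, not_le] at hij'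
    refine ⟨(j'.castSucc, i'.pred ?_), ?_, ?_⟩
    · rintro rfl
      simp only [Fin.val_zero, not_lt_zero] at hij'
    · simpa [T] using! Nat.le_sub_one_of_lt hij'
    · simp only [φ, Fin.castLT_castSucc, Fin.succ_pred]
  · rintro ⟨i, j⟩ hij
    have hij' : (i : ℕ) ≤ (j : ℕ) := (Finset.mem_filter.mp hij).right
    have hi : i = (i.castLT (lt_of_le_of_lt hij' j.is_lt)).castSucc := (Fin.castSucc_castLT _ _).symm
    have hc := cubeFace_comm F n (i.castLT (lt_of_le_of_lt hij' j.is_lt)) j hij' a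
    rw [← hi] at hc
    simp only [φ, hc, ← neg_smul]
    congr 1
    simp only [Fin.val_succ, Fin.val_castLT]
    ring

/-- The chain complex `⋯ ⟶ ⨁_{Q₂} F(x) ⟶ ⨁_{Q₁} F(x) ⟶ ⨁_{Q₀} F(x) ⟶ 0`, with differentials
`dₙ(x, a₁, …, aₙ, f) = ∑_{s=1}^n (-1)ˢ ((x·aₛ, a₁, …, âₛ, …, aₙ, F(x ⟶ x·aₛ)(f)) -
(x, a₁, …, âₛ, …, aₙ, f))`. -/
def cubeComplex : ChainComplex AddCommGrpCat.{max u v w} ℕ :=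
  ChainComplex.of (fun n => .of (CubeChains F n)) (fun n => AddCommGrpCat.ofHom (cubeD F n))
    (fun n => by rw [← AddCommGrpCat.ofHom_comp, cubeD_squared]; rfl)

end Cubes

end TraceHomology

end

/-!
The homology `Hₙ(C, F)` and the homology of the cubical complex are both obtained from a resolution
of the constant presheaf `ℤ` on `C = K_*(S)` by free presheaves `⨁ᵢ ℤ[Hom(-, cᵢ)]`, by applying
`- ⊗_C F`, that is, by replacing `⨁ᵢ ℤ[Hom(-, cᵢ)]` with `⨁ᵢ F(cᵢ)`. Two such resolutions are
homotopy equivalent, so that they give the same homology.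

To avoid presheaves, free presheaves are encoded by families of objects (`FreeFam`), and a morphism
is given by the images of the universal elements, which are elements of the free abelian groups
`Lin c Y` on the arrows from `c` to the members of `Y`. The functor `- ⊗_C F` is `realize F`. The
comparison theorem for resolutions is `IsResolution.homotopyEquiv`.

The complex of the nerve is a resolution (`isResolution_barComplex`) since
`(c ⟶ c₀ ⟶ ⋯ ⟶ cₙ) ↦ (c = c ⟶ c₀ ⟶ ⋯ ⟶ cₙ)` is a contraction of its augmentation.

For the cubical complex (`isResolution_cubeFamComplex`), every trace `w` acts on `S_*`, so that the
arrows from `c` to the bases of the `n`-cubes correspond to the cells `(w; a₁, …, aₙ)` with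
`w ∈ M(E, I)`. The upper faces `(w aₛ; …, âₛ, …)` preserve the total trace `w a₁ ⋯ aₙ`, whereas the
lower faces `(w; …, âₛ, …)` shorten it. Hence it suffices to contract the part of the differential
formed by the upper faces. The cells with a given total trace `x` form the simplex of all generators
which divide `x` on the right: these are pairwise independent (`mul_gen_eq_mul_gen`), hence finite
in number, and the simplex is contracted onto its least vertex (`topD_cubeContract_add`). Moving a
cycle along this contraction shortens it modulo a boundary (`exists_cubeFamD_eq`).
-/

noncomputable section

namespace TraceHomology

/-! ### The additive category of free families -/

section FreeFamilies

variable (C : Type u) [Category.{v} C]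

/-- A family `(cᵢ)` of objects of `C`. It stands for the formal direct sum of the `cᵢ` in the
free additive category on `C`, equivalently for the presheaf `⨁ᵢ ℤ[Hom(-, cᵢ)]`. -/
structure FreeFam where
  /-- The index type. -/
  ι : Type t
  /-- The members of the family. -/
  obj : ι → C

variable {C}

/-- The value at `c` of the presheaf `⨁ⱼ ℤ[Hom(-, cⱼ)]`: the free abelian group on the arrows from
`c` to the members of the family. -/
abbrev Lin (c : C) (Y : FreeFam.{u, t} C) : Type max t v := (Σ j : Y.ι, (c ⟶ Y.obj j)) →₀ ℤ

/-- The basis element of `Lin c Y` given by an arrow `c ⟶ cⱼ`. -/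
def bas {c : C} (Y : FreeFam.{u, t} C) (j : Y.ι) (f : c ⟶ Y.obj j) : Lin c Y :=
  Finsupp.single ⟨j, f⟩ 1

lemma bas_congr {c : C} {Y : FreeFam.{u, t} C} {i j : Y.ι} (h : i = j) (f : c ⟶ Y.obj i)
    (g : c ⟶ Y.obj j) (hfg : f ≫ eqToHom (congrArg Y.obj h) = g) : bas Y i f = bas Y j g := by
  subst h
  simp only [eqToHom_refl, Category.comp_id] at hfg
  rw [hfg]

/-- The homomorphism out of `Lin c Y` with prescribed values on the basis. -/
def linLift {c : C} {Y : FreeFam.{u, t} C} {A : Type*} [AddCommGroup A]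
    (φ : ∀ j, (c ⟶ Y.obj j) → A) : Lin c Y →+ A :=
  Finsupp.liftAddHom fun p => zmultiplesHom A (φ p.1 p.2)

@[simp]
lemma linLift_bas {c : C} {Y : FreeFam.{u, t} C} {A : Type*} [AddCommGroup A]
    (φ : ∀ j, (c ⟶ Y.obj j) → A) (j : Y.ι) (f : c ⟶ Y.obj j) :
    linLift φ (bas Y j f) = φ j f := by
  simp [linLift, bas]

lemma lin_hom_ext {c : C} {Y : FreeFam.{u, t} C} {A : Type*} [AddCommGroup A]
    {φ ψ : Lin c Y →+ A} (h : ∀ j f, φ (bas Y j f) = ψ (bas Y j f)) : φ = ψ := by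
  refine Finsupp.addHom_ext fun p n => ?_
  have hp : Finsupp.single p n = n • bas Y p.1 p.2 := by simp [bas]
  rw [hp, map_zsmul, map_zsmul, h]

/-- Restriction along an arrow `b ⟶ c`. -/
def pre {b c : C} (f : b ⟶ c) (Y : FreeFam.{u, t} C) : Lin c Y →+ Lin b Y :=
  linLift fun j g => bas Y j (f ≫ g)

@[simp]
lemma pre_bas {b c : C} (f : b ⟶ c) (Y : FreeFam.{u, t} C) (j : Y.ι) (g : c ⟶ Y.obj j) :
    pre f Y (bas Y j g) = bas Y j (f ≫ g) := linLift_bas _ _ _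

lemma pre_id {c : C} (Y : FreeFam.{u, t} C) (z : Lin c Y) : pre (𝟙 c) Y z = z :=
  DFunLike.congr_fun (f := pre (𝟙 c) Y) (g := AddMonoidHom.id _)
    (lin_hom_ext fun j f => by simp) z

/-- The homomorphism `Lin c X ⟶ Lin c Y` induced by a morphism of free families, the latter
being given by the images of the universal elements. -/
def linMap {X Y : FreeFam.{u, t} C} (m : ∀ i, Lin (X.obj i) Y) (c : C) : Lin c X →+ Lin c Y :=
  linLift fun i f => pre f Y (m i)

@[simp]
lemma linMap_bas {X Y : FreeFam.{u, t} C} (m : ∀ i, Lin (X.obj i) Y) {c : C} (i : X.ι)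
    (f : c ⟶ X.obj i) : linMap m c (bas X i f) = pre f Y (m i) := linLift_bas _ _ _

lemma pre_pre {a b c : C} (f : a ⟶ b) (g : b ⟶ c) (Y : FreeFam.{u, t} C) (z : Lin c Y) :
    pre f Y (pre g Y z) = pre (f ≫ g) Y z :=
  DFunLike.congr_fun (f := (pre f Y).comp (pre g Y)) (g := pre (f ≫ g) Y)
    (lin_hom_ext fun j h => by simp) z

lemma linMap_pre {X Y : FreeFam.{u, t} C} (m : ∀ i, Lin (X.obj i) Y) {b c : C} (f : b ⟶ c)
    (z : Lin c X) : linMap m b (pre f X z) = pre f Y (linMap m c z) :=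
  DFunLike.congr_fun (f := (linMap m b).comp (pre f X)) (g := (pre f Y).comp (linMap m c))
    (lin_hom_ext fun i g => by simp [pre_pre]) z

lemma linMap_linMap {X Y Z : FreeFam.{u, t} C} (m : ∀ i, Lin (X.obj i) Y) (n : ∀ j, Lin (Y.obj j) Z)
    {c : C} (z : Lin c X) : linMap n c (linMap m c z) = linMap (fun i => linMap n _ (m i)) c z :=
  DFunLike.congr_fun (f := (linMap n c).comp (linMap m c))
    (g := linMap (fun i => linMap n _ (m i)) c)
    (lin_hom_ext fun i g => by simp [linMap_pre]) z

lemma linMap_bas_id {X : FreeFam.{u, t} C} {c : C} (z : Lin c X) :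
    linMap (fun i => bas X i (𝟙 _)) c z = z :=
  DFunLike.congr_fun (f := linMap (fun i => bas X i (𝟙 _)) c) (g := AddMonoidHom.id _)
    (lin_hom_ext fun j f => by simp) z

/-- The category of free families: a morphism `X ⟶ Y` consists of an element of `Lin (X.obj i) Y`
for every `i`, that is, by the Yoneda lemma, of a homomorphism of presheaves. -/
instance : Category (FreeFam.{u, t} C) where
  Hom X Y := ∀ i, Lin (X.obj i) Y
  id X := fun i => bas X i (𝟙 _)
  comp m n := fun i => linMap n _ (m i)
  id_comp m := funext fun i => by rw [linMap_bas, pre_id]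
  comp_id m := funext fun i => linMap_bas_id _
  assoc m n k := funext fun i => linMap_linMap _ _ _

/-- The image of a universal element under a morphism of free families. -/
def coeff {X Y : FreeFam.{u, t} C} (m : X ⟶ Y) (i : X.ι) : Lin (X.obj i) Y := m i

/-- The morphism of free families with prescribed images of the universal elements. -/
def homMk {X Y : FreeFam.{u, t} C} (m : ∀ i, Lin (X.obj i) Y) : X ⟶ Y := m

/-- The homomorphism `Lin c X ⟶ Lin c Y` induced by a morphism of free families. -/
def ev {X Y : FreeFam.{u, t} C} (m : X ⟶ Y) (c : C) : Lin c X →+ Lin c Y := linMap m c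

instance : Preadditive (FreeFam.{u, t} C) where
  homGroup X Y := inferInstanceAs (AddCommGroup (∀ i, Lin (X.obj i) Y))
  add_comp X Y Z m m' n := funext fun i => map_add (linMap n _) (m i) (m' i)
  comp_add X Y Z m n n' := funext fun i =>
    DFunLike.congr_fun (f := linMap (fun j => n j + n' j) _) (g := linMap n _ + linMap n' _)
      (lin_hom_ext fun j f => by simp) (m i)

section

variable {X Y Z : FreeFam.{u, t} C}

@[ext]
lemma freeFam_hom_ext {m n : X ⟶ Y} (h : ∀ i, coeff m i = coeff n i) : m = n := funext h

@[simp]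
lemma coeff_homMk (m : ∀ i, Lin (X.obj i) Y) (i : X.ι) : coeff (homMk m) i = m i := rfl

lemma coeff_id (i : X.ι) : coeff (𝟙 X) i = bas X i (𝟙 _) := rfl

lemma coeff_comp (m : X ⟶ Y) (n : Y ⟶ Z) (i : X.ι) :
    coeff (m ≫ n) i = ev n _ (coeff m i) := rfl

@[simp]
lemma coeff_zero (i : X.ι) : coeff (0 : X ⟶ Y) i = 0 := rfl

@[simp]
lemma coeff_add (m n : X ⟶ Y) (i : X.ι) : coeff (m + n) i = coeff m i + coeff n i := rfl

@[simp]
lemma coeff_sub (m n : X ⟶ Y) (i : X.ι) : coeff (m - n) i = coeff m i - coeff n i := rfl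

@[simp]
lemma ev_bas (m : X ⟶ Y) {c : C} (i : X.ι) (f : c ⟶ X.obj i) :
    ev m c (bas X i f) = pre f Y (coeff m i) := linMap_bas m i f

lemma ev_comp (m : X ⟶ Y) (n : Y ⟶ Z) {c : C} (z : Lin c X) :
    ev (m ≫ n) c z = ev n c (ev m c z) := (linMap_linMap m n z).symm

/-- Evaluation at `c` is additive in the morphism of free families. -/
def evHom (X Y : FreeFam.{u, t} C) (c : C) : (X ⟶ Y) →+ Lin c X →+ Lin c Y where
  toFun m := ev m c
  map_zero' := lin_hom_ext fun i f => by simp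
  map_add' m n := lin_hom_ext fun i f => by simp

/-- The augmentation `Lin c Y ⟶ ℤ`, the sum of the coefficients. -/
def eps (c : C) (Y : FreeFam.{u, t} C) : Lin c Y →+ ℤ := linLift fun _ _ => 1

@[simp]
lemma eps_bas {c : C} (j : Y.ι) (f : c ⟶ Y.obj j) : eps c Y (bas Y j f) = 1 := linLift_bas _ _ _

lemma eps_pre {b c : C} (f : b ⟶ c) (z : Lin c Y) : eps b Y (pre f Y z) = eps c Y z :=
  DFunLike.congr_fun (f := (eps b Y).comp (pre f Y)) (g := eps c Y)
    (lin_hom_ext fun j h => by simp) z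

/-- A morphism of free families whose coefficients all have the same augmentation `k` multiplies
augmentations by `k`. -/
lemma eps_ev (m : X ⟶ Y) (k : ℤ) (hm : ∀ i, eps _ Y (coeff m i) = k) {c : C} (z : Lin c X) :
    eps c Y (ev m c z) = k * eps c X z :=
  DFunLike.congr_fun (f := (eps c Y).comp (ev m c)) (g := (AddMonoidHom.mulLeft k).comp (eps c X))
    (lin_hom_ext fun j h => by simp [eps_pre, hm]) z

end

end FreeFamilies

/-! ### Realization with coefficients in a functor -/

section Realization

variable {C : Type u} [Category.{v} C] (F : C ⥤ AddCommGrpCat.{w})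

/-- The action of `Lin c Y` on `F c` with values in `⨁ⱼ F(cⱼ)`. -/
def act {c : C} (Y : FreeFam.{u, t} C) : Lin c Y →+ F.obj c →+ FSum F Y.obj :=
  linLift fun j f => push F Y.obj j f

@[simp]
lemma act_bas {c : C} (Y : FreeFam.{u, t} C) (j : Y.ι) (f : c ⟶ Y.obj j) :
    act F Y (bas Y j f) = push F Y.obj j f := linLift_bas _ _ _

lemma act_pre {b c : C} (f : b ⟶ c) (Y : FreeFam.{u, t} C) (z : Lin c Y) (a : F.obj b) :
    act F Y (pre f Y z) a = act F Y z (F.map f a) :=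
  DFunLike.congr_fun (f := ((act F Y).comp (pre f Y)).flip a) (g := (act F Y).flip (F.map f a))
    (lin_hom_ext fun j h => by simp [push_map]) z

/-- The homomorphism `⨁ᵢ F(cᵢ) ⟶ ⨁ⱼ F(dⱼ)` induced by a morphism of free families. -/
def realizeMap {X Y : FreeFam.{u, t} C} (m : X ⟶ Y) : FSum F X.obj →+ FSum F Y.obj :=
  glue F X.obj fun i => act F Y (coeff m i)

lemma realizeMap_push {X Y : FreeFam.{u, t} C} (m : X ⟶ Y) {c : C} (i : X.ι) (f : c ⟶ X.obj i)
    (a : F.obj c) :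
    realizeMap F m (push F X.obj i f a) = act F Y (coeff m i) (F.map f a) := glue_push _ _ _ _ _ _

lemma realizeMap_act {X Y : FreeFam.{u, t} C} (m : X ⟶ Y) {c : C} (z : Lin c X) (a : F.obj c) :
    realizeMap F m (act F X z a) = act F Y (ev m c z) a :=
  DFunLike.congr_fun (f := (realizeMap F m).comp ((act F X).flip a))
    (g := ((act F Y).comp (ev m c)).flip a)
    (lin_hom_ext fun j h => by simp [realizeMap_push, act_pre]) z

/-- Realization of morphisms of free families, as an additive map. -/
def realizeHom (X Y : FreeFam.{u, t} C) : (X ⟶ Y) →+ FSum F X.obj →+ FSum F Y.obj :=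
  AddMonoidHom.mk' (realizeMap F) fun m n => hom_ext fun i a => by
    simp only [realizeMap_push, coeff_add, map_add, AddMonoidHom.add_apply]

lemma realizeMap_comp {X Y Z : FreeFam.{u, t} C} (m : X ⟶ Y) (n : Y ⟶ Z) :
    realizeMap F (m ≫ n) = (realizeMap F n).comp (realizeMap F m) := hom_ext fun i a => by
  simp only [AddMonoidHom.comp_apply, realizeMap_push, realizeMap_act, coeff_comp]

/-- The additive functor `(cᵢ) ↦ ⨁ᵢ F(cᵢ)`, that is, the tensor product over `C` with `F`. -/
def realize : FreeFam.{u, t} C ⥤ AddCommGrpCat.{max t w} where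
  obj X := .of (FSum F X.obj)
  map m := AddCommGrpCat.ofHom (realizeMap F m)
  map_id X := by
    refine AddCommGrpCat.hom_ext (hom_ext fun i a => ?_)
    simp [realizeMap_push, coeff_id]
  map_comp m n := by rw [realizeMap_comp, AddCommGrpCat.ofHom_comp]

instance : (realize.{u, v, w, t} F).Additive where
  map_add {X Y m n} := AddCommGrpCat.hom_ext (map_add (realizeHom F X Y) m n)

/-- The functor `ℤ[Hom(c, -)]`. -/
def linRep (c : C) : C ⥤ AddCommGrpCat.{v} where
  obj y := .of ((c ⟶ y) →₀ ℤ)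
  map f := AddCommGrpCat.ofHom (Finsupp.mapDomain.addMonoidHom fun g => g ≫ f)
  map_id y := by
    refine AddCommGrpCat.hom_ext (Finsupp.addHom_ext fun g n => ?_)
    simp
  map_comp f g := by
    refine AddCommGrpCat.hom_ext (Finsupp.addHom_ext fun h n => ?_)
    simp

/-- The universal element of `ℤ[Hom(c, -)]`. -/
def linRepUniv (c : C) : (linRep c).obj c := (Finsupp.single (𝟙 c) 1 : (c ⟶ c) →₀ ℤ)

/-- The Yoneda lemma: an element of `Lin c Y` is determined by its action on the universal element
of `ℤ[Hom(c, -)]`. -/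
lemma lin_eq_of_act_linRep {c : C} {Y : FreeFam.{u, t} C} {z z' : Lin c Y}
    (h : act (linRep c) Y z (linRepUniv c) = act (linRep c) Y z' (linRepUniv c)) : z = z' := by
  let ψ : ∀ j, (linRep c).obj (Y.obj j) →+ Lin c Y := fun j =>
    (Finsupp.liftAddHom fun f => zmultiplesHom _ (bas Y j f) : ((c ⟶ Y.obj j) →₀ ℤ) →+ Lin c Y)
  have hψ : ∀ j (f : c ⟶ Y.obj j), ψ j ((linRep c).map f (linRepUniv c)) = bas Y j f :=
    fun j f => by
      change (Finsupp.liftAddHom fun f => zmultiplesHom _ (bas Y j f) :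
        ((c ⟶ Y.obj j) →₀ ℤ) →+ Lin c Y) (Finsupp.mapDomain (fun g => g ≫ f)
          (Finsupp.single (𝟙 c) 1)) = _
      simp [Finsupp.mapDomain_single]
  have key : ∀ x : Lin c Y,
      glue (linRep c) Y.obj ψ (act (linRep c) Y x (linRepUniv c)) = x := fun x =>
    DFunLike.congr_fun (f := (glue (linRep c) Y.obj ψ).comp
      ((act (linRep c) Y).flip (linRepUniv c))) (g := AddMonoidHom.id _)
      (lin_hom_ext fun j f => by
        rw [AddMonoidHom.comp_apply, AddMonoidHom.flip_apply, act_bas, glue_push, hψ,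
          AddMonoidHom.id_apply]) x
  rw [← key z, h, key]

/-- The realization functors are jointly faithful. -/
lemma eq_of_realizeMap_eq {X Y : FreeFam.{u, t} C} {m n : X ⟶ Y}
    (h : ∀ F : C ⥤ AddCommGrpCat.{v}, realizeMap F m = realizeMap F n) : m = n := by
  refine freeFam_hom_ext fun i => lin_eq_of_act_linRep ?_
  have := DFunLike.congr_fun (h (linRep (X.obj i)))
    (push _ X.obj i (𝟙 _) (linRepUniv (X.obj i)))
  simpa only [realizeMap_push, CategoryTheory.Functor.map_id, AddCommGrpCat.id_apply] using this

end Realization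

/-! ### Free resolutions of the constant functor -/

section Resolutions

variable {C : Type u} [Category.{v} C]

/-- A chain complex of free families is a resolution of the constant presheaf `ℤ` if, at every
object `c`, the augmented complex `⋯ ⟶ Lin c Y₁ ⟶ Lin c Y₀ ⟶ ℤ ⟶ 0` is exact. -/
structure IsResolution (Y : ChainComplex (FreeFam.{u, t} C) ℕ) : Prop where
  exists_eps_eq_one : ∀ c, ∃ z, eps c (Y.X 0) z = 1
  eps_d : ∀ i, eps _ (Y.X 0) (coeff (Y.d 1 0) i) = 0
  exact_zero : ∀ c z, eps c (Y.X 0) z = 0 → ∃ y, ev (Y.d 1 0) c y = z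
  exact_succ : ∀ n c z, ev (Y.d (n + 1) n) c z = 0 → ∃ y, ev (Y.d (n + 2) (n + 1)) c y = z

namespace IsResolution

variable {Y : ChainComplex (FreeFam.{u, t} C) ℕ}


/-- Free families are projective: a morphism into `Y₀` with vanishing augmentations lifts. -/
lemma lift_zero (hY : IsResolution Y) {T : FreeFam.{u, t} C} (f : T ⟶ Y.X 0)
    (hf : ∀ i, eps _ (Y.X 0) (coeff f i) = 0) :
    ∃ g : T ⟶ Y.X 1, g ≫ Y.d 1 0 = f := by
  choose g hg using fun i => hY.exact_zero _ (coeff f i) (hf i)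
  exact ⟨homMk g, freeFam_hom_ext fun i => hg i⟩

/-- Free families are projective: a morphism into the cycles of positive degree lifts. -/
lemma lift_succ (hY : IsResolution Y) {T : FreeFam.{u, t} C} {n : ℕ} (f : T ⟶ Y.X (n + 1))
    (hf : f ≫ Y.d (n + 1) n = 0) : ∃ g : T ⟶ Y.X (n + 2), g ≫ Y.d (n + 2) (n + 1) = f := by
  choose g hg using fun i => hY.exact_succ n _ (coeff f i) (congrFun hf i)
  exact ⟨homMk g, freeFam_hom_ext fun i => hg i⟩

lemma exists_hom_zero (hY : IsResolution Y) (T : FreeFam.{u, t} C) :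
    ∃ f : T ⟶ Y.X 0, ∀ i, eps _ (Y.X 0) (coeff f i) = 1 := by
  choose f hf using fun i => hY.exists_eps_eq_one (T.obj i)
  exact ⟨homMk f, hf⟩

/-- The comparison theorem, existence: there is a chain map lifting the identity of `ℤ`. -/
lemma exists_hom (hY : IsResolution Y) {X : ChainComplex (FreeFam.{u, t} C) ℕ}
    (hX : IsResolution X) :
    ∃ f : X ⟶ Y, ∀ i, eps _ (Y.X 0) (coeff (f.f 0) i) = 1 := by
  obtain ⟨f₀, hf₀⟩ := hY.exists_hom_zero (X.X 0)
  obtain ⟨f₁, hf₁⟩ := hY.lift_zero (X.d 1 0 ≫ f₀) fun i => by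
    rw [coeff_comp, eps_ev f₀ 1 hf₀, hX.eps_d, mul_zero]
  refine ⟨ChainComplex.mkHom X Y f₀ f₁ hf₁ fun n p =>
    ⟨(hY.lift_succ (X.d (n + 2) (n + 1) ≫ p.2.1) ?_).choose,
      (hY.lift_succ (X.d (n + 2) (n + 1) ≫ p.2.1) ?_).choose_spec⟩, fun i => hf₀ i⟩
  all_goals rw [Category.assoc, p.2.2, X.d_comp_d_assoc, Limits.zero_comp]

/-- The comparison theorem, uniqueness: a chain map inducing zero on `ℤ` is homotopic to zero. -/
lemma homotopy_zero (hY : IsResolution Y) {X : ChainComplex (FreeFam.{u, t} C) ℕ}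
    (e : X ⟶ Y)
    (he : ∀ i, eps _ (Y.X 0) (coeff (e.f 0) i) = 0) : Nonempty (Homotopy e 0) := by
  obtain ⟨h₀, hh₀⟩ := hY.lift_zero (e.f 0) he
  obtain ⟨h₁, hh₁⟩ := hY.lift_succ (e.f 1 - X.d 1 0 ≫ h₀) (by
    rw [Preadditive.sub_comp, Category.assoc, hh₀, e.comm, sub_self])
  have step (n : ℕ) (k : X.X n ⟶ Y.X (n + 1)) (k' : X.X (n + 1) ⟶ Y.X (n + 2))
      (hk : e.f (n + 1) = X.d (n + 1) n ≫ k + k' ≫ Y.d (n + 2) (n + 1)) :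
      ∃ g, g ≫ Y.d (n + 3) (n + 2) = e.f (n + 2) - X.d (n + 2) (n + 1) ≫ k' :=
    hY.lift_succ _ (by
      rw [Preadditive.sub_comp, Category.assoc, sub_eq_zero, e.comm,
        ← sub_eq_iff_eq_add'.2 hk, Preadditive.comp_sub, X.d_comp_d_assoc, Limits.zero_comp,
        sub_zero])
  exact ⟨Homotopy.mkInductive e h₀ hh₀.symm h₁ (by rw [hh₁]; abel) fun n p =>
    ⟨(step n p.1 p.2.1 p.2.2).choose, by rw [(step n p.1 p.2.1 p.2.2).choose_spec]; abel⟩⟩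

/-- Two resolutions of the constant presheaf by free families are homotopy equivalent. -/
lemma homotopyEquiv (hY : IsResolution Y) {X : ChainComplex (FreeFam.{u, t} C) ℕ}
    (hX : IsResolution X) :
    Nonempty (HomotopyEquiv X Y) := by
  obtain ⟨f, hf⟩ := hY.exists_hom hX
  obtain ⟨g, hg⟩ := hX.exists_hom hY
  obtain ⟨h⟩ := hX.homotopy_zero (f ≫ g - 𝟙 X) fun i => by
    change eps _ _ (coeff (f.f 0 ≫ g.f 0) i - coeff (𝟙 (X.X 0)) i) = 0
    rw [map_sub, coeff_comp, eps_ev _ 1 hg, hf, coeff_id, eps_bas, mul_one, sub_self]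
  obtain ⟨k⟩ := hY.homotopy_zero (g ≫ f - 𝟙 Y) fun i => by
    change eps _ _ (coeff (g.f 0 ≫ f.f 0) i - coeff (𝟙 (Y.X 0)) i) = 0
    rw [map_sub, coeff_comp, eps_ev _ 1 hf, hg, coeff_id, eps_bas, mul_one, sub_self]
  exact ⟨⟨f, g, (Homotopy.equivSubZero).symm h, (Homotopy.equivSubZero).symm k⟩⟩

end IsResolution

/-- Any two resolutions of the constant presheaf compute the same homology with coefficients in a
functor. -/
lemma nonempty_homology_iso {X Y : ChainComplex (FreeFam.{u, t} C) ℕ} (hX : IsResolution X)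
    (hY : IsResolution Y) (F : C ⥤ AddCommGrpCat.{w}) (n : ℕ) :
    Nonempty ((((realize F).mapHomologicalComplex _).obj X).homology n ≅
      (((realize F).mapHomologicalComplex _).obj Y).homology n) := by
  obtain ⟨e⟩ := hY.homotopyEquiv hX
  exact ⟨((realize F).mapHomotopyEquiv e).toHomologyIso n⟩

end Resolutions

/-! ### The bar resolution -/

section Bar

variable (C : Type u) [Category.{v} C]

/-- The family of the first objects of the chains `c₀ ⟶ ⋯ ⟶ cₙ`. -/
abbrev chainFam (n : ℕ) : FreeFam.{u, max u v} C := ⟨ComposableArrows C n, fun σ => σ.left⟩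

/-- The simplicial free family formed by the first objects of the simplices of the nerve. -/
def barFam : SimplicialObject (FreeFam.{u, max u v} C) where
  obj Δ := ⟨(nerve C).obj Δ, fun σ => firstObj σ⟩
  map φ := homMk fun σ => bas _ ((nerve C).map φ σ) (firstMap φ σ)
  map_id Δ := freeFam_hom_ext fun σ => by
    rw [coeff_homMk, coeff_id]
    exact bas_congr rfl _ _ (firstMap_id σ _)
  map_comp φ ψ := freeFam_hom_ext fun σ => by
    rw [coeff_homMk, coeff_comp, coeff_homMk, ev_bas, coeff_homMk, pre_bas]
    exact bas_congr rfl _ _ (firstMap_comp φ ψ σ _)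

/-- The complex of free families formed by the first objects of the simplices of the nerve. -/
def barComplex : ChainComplex (FreeFam.{u, max u v} C) ℕ :=
  (AlgebraicTopology.alternatingFaceMapComplex _).obj (barFam C)

variable {C}

/-- Realizing the simplicial free family of the nerve gives the simplicial replacement. -/
def realizeBarIso (F : C ⥤ AddCommGrpCat.{w}) :
    ((SimplicialObject.whiskering _ _).obj (realize F)).obj (barFam C) ≅
      simplicialReplacement F :=
  NatIso.ofComponents (fun _ => Iso.refl _) fun {Δ Δ'} φ => by
    refine (Category.comp_id _).trans (Eq.trans ?_ (Category.id_comp _).symm)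
    refine AddCommGrpCat.hom_ext (hom_ext fun σ a => ?_)
    refine (realizeMap_push F ((barFam C).map φ) σ (𝟙 _) a).trans ?_
    refine Eq.trans ?_ (glue_push F _ _ σ (𝟙 _) a).symm
    exact DFunLike.congr_fun (act_bas F _ _ _) _

/-- Realizing the bar complex gives the complex which defines the homology of the category. -/
def realizeBarComplexIso (F : C ⥤ AddCommGrpCat.{w}) :
    ((realize F).mapHomologicalComplex _).obj (barComplex C) ≅ categoryComplex F :=
  eqToIso (Functor.congr_obj (AlgebraicTopology.map_alternatingFaceMapComplex (realize F))
    (barFam C)) ≪≫ (AlgebraicTopology.alternatingFaceMapComplex _).mapIso (realizeBarIso F)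

/-- The chain obtained by omitting `cᵢ`. -/
def chainFace {n : ℕ} (i : Fin (n + 2)) (σ : ComposableArrows C (n + 1)) : ComposableArrows C n :=
  (nerve C).δ i σ

/-- The arrow between the first objects of a chain and of its `i`-th face. -/
def chainFaceMap {n : ℕ} (i : Fin (n + 2)) (σ : ComposableArrows C (n + 1)) :
    σ.left ⟶ (chainFace i σ).left :=
  firstMap (SimplexCategory.δ i).op σ

/-- The `i`-th face of the bar complex. -/
def barFace (n : ℕ) (i : Fin (n + 2)) : chainFam C (n + 1) ⟶ chainFam C n :=
  homMk fun σ => bas (chainFam C n) (chainFace i σ) (chainFaceMap i σ)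

/-- The basis element `c ⟶ c₀ ⟶ ⋯ ⟶ cₙ`. -/
def chainBas {n : ℕ} {c : C} (σ : ComposableArrows C n) (f : c ⟶ σ.left) : Lin c (chainFam C n) :=
  bas (chainFam C n) σ f

lemma chain_hom_ext {n : ℕ} {c : C} {A : Type*} [AddCommGroup A]
    {φ ψ : Lin c (chainFam C n) →+ A}
    (h : ∀ (σ : ComposableArrows C n) (f : c ⟶ σ.left), φ (chainBas σ f) = ψ (chainBas σ f)) :
    φ = ψ :=
  lin_hom_ext h

lemma ev_barFace_bas (n : ℕ) (i : Fin (n + 2)) {c : C} (σ : ComposableArrows C (n + 1))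
    (f : c ⟶ σ.left) :
    ev (barFace n i) c (chainBas σ f) = chainBas (chainFace i σ) (f ≫ chainFaceMap i σ) := by
  rw [chainBas, ev_bas, barFace, coeff_homMk, pre_bas]
  rfl

lemma barComplex_d (n : ℕ) :
    (barComplex C).d (n + 1) n = ∑ i : Fin (n + 2), (-1 : ℤ) ^ (i : ℕ) • barFace n i :=
  AlgebraicTopology.AlternatingFaceMapComplex.obj_d_eq (barFam C) n

lemma ev_barComplex_d (n : ℕ) (c : C) (z : Lin c (chainFam C (n + 1))) :
    ev ((barComplex C).d (n + 1) n) c z =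
      ∑ i : Fin (n + 2), (-1 : ℤ) ^ (i : ℕ) • ev (barFace n i) c z := by
  rw [barComplex_d]
  refine (DFunLike.congr_fun (map_sum (evHom (chainFam C (n + 1)) (chainFam C n) c)
    (fun i : Fin (n + 2) => (-1 : ℤ) ^ (i : ℕ) • barFace n i) Finset.univ) z).trans ?_
  rw [AddMonoidHom.finsetSum_apply]
  refine Finset.sum_congr rfl fun i _ => ?_
  rw [map_zsmul]
  rfl

/-- The contraction of the bar complex, `(c ⟶ c₀ ⟶ ⋯ ⟶ cₙ) ↦ (c = c ⟶ c₀ ⟶ ⋯ ⟶ cₙ)`. -/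
def barContract (n : ℕ) (c : C) : Lin c (chainFam C n) →+ Lin c (chainFam C (n + 1)) :=
  linLift fun σ f => chainBas (ComposableArrows.precomp σ f) (𝟙 c)

lemma barContract_bas {n : ℕ} {c : C} (σ : ComposableArrows C n) (f : c ⟶ σ.left) :
    barContract n c (chainBas σ f) = chainBas (σ.precomp f) (𝟙 c) := linLift_bas _ _ _

lemma barFace_zero_barContract (n : ℕ) (c : C) (z : Lin c (chainFam C n)) :
    ev (barFace n 0) c (barContract n c z) = z :=
  DFunLike.congr_fun (f := (ev (barFace n 0) c).comp (barContract n c)) (g := AddMonoidHom.id _)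
    (chain_hom_ext fun σ f => by
      rw [AddMonoidHom.comp_apply, barContract_bas]
      refine (ev_barFace_bas n 0 (σ.precomp f) (𝟙 c)).trans ?_
      exact congrArg (chainBas σ) (Category.id_comp f)) z

lemma chainFace_succ_precomp {n : ℕ} (i : Fin (n + 2)) (σ : ComposableArrows C (n + 1)) {c : C}
    (f : c ⟶ σ.left) :
    chainFace i.succ (σ.precomp f) = (chainFace i σ).precomp (f ≫ chainFaceMap i σ) := by
  refine ComposableArrows.ext_succ rfl ?_ ?_
  · exact ConcreteCategory.congr_hom ((nerve C).δ_comp_δ (Fin.zero_le i)) (σ.precomp f)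
  · refine (conj_eqToHom_iff_heq' _ _ _ _).2 ?_
    refine Fin.cases ?_ (fun i => ?_) i
    · rfl
    · exact heq_of_eq ((Category.comp_id f).symm.trans
        (congrArg (f ≫ ·) (ComposableArrows.map'_self σ 0).symm))

lemma barFace_succ_barContract (n : ℕ) (i : Fin (n + 2)) (c : C)
    (z : Lin c (chainFam C (n + 1))) :
    ev (barFace (n + 1) i.succ) c (barContract (n + 1) c z) =
      barContract n c (ev (barFace n i) c z) :=
  DFunLike.congr_fun (f := (ev (barFace (n + 1) i.succ) c).comp (barContract (n + 1) c))
    (g := (barContract n c).comp (ev (barFace n i) c))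
    (chain_hom_ext fun σ f => by
      rw [AddMonoidHom.comp_apply, AddMonoidHom.comp_apply, barContract_bas, ev_barFace_bas,
        barContract_bas]
      refine (ev_barFace_bas (n + 1) i.succ (σ.precomp f) (𝟙 c)).trans ?_
      refine bas_congr (chainFace_succ_precomp i σ f) _ _ ?_
      exact (Category.comp_id _).trans (Category.id_comp _)) z

lemma barFace_one_barContract (c : C) (z : Lin c (chainFam C 0)) :
    ev (barFace 0 1) c (barContract 0 c z) =
      eps c (chainFam C 0) z • chainBas (ComposableArrows.mk₀ c) (𝟙 c) :=
  DFunLike.congr_fun (f := (ev (barFace 0 1) c).comp (barContract 0 c))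
    (g := (zmultiplesHom _ (chainBas (ComposableArrows.mk₀ c) (𝟙 c))).comp (eps c (chainFam C 0)))
    (chain_hom_ext fun σ f => by
      rw [AddMonoidHom.comp_apply, barContract_bas, AddMonoidHom.comp_apply, chainBas, eps_bas,
        zmultiplesHom_apply, one_smul]
      refine (ev_barFace_bas 0 1 (σ.precomp f) (𝟙 c)).trans ?_
      have h : chainFace 1 (σ.precomp f) = ComposableArrows.mk₀ c := ComposableArrows.ext₀ rfl
      exact bas_congr h _ _
        ((Category.comp_id _).trans (Category.id_comp _))) z

lemma eps_barComplex_d (σ : ComposableArrows C 1) :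
    eps _ (chainFam C 0) (coeff ((barComplex C).d 1 0 : chainFam C 1 ⟶ chainFam C 0) σ) = 0 := by
  have hd : (barComplex C).d 1 0 = (barFace 0 0 - barFace 0 1 : chainFam C 1 ⟶ chainFam C 0) := by
    refine (barComplex_d 0).trans ((Fin.sum_univ_two _).trans ?_)
    rw [sub_eq_add_neg, Fin.val_zero, pow_zero, one_smul, Fin.val_one, pow_one, neg_smul, one_smul]
    rfl
  have hε (i : Fin 2) : eps _ (chainFam C 0) (coeff (barFace 0 i) σ) = 1 := eps_bas _ _
  refine (congrArg (fun m : chainFam C 1 ⟶ chainFam C 0 => eps _ (chainFam C 0) (coeff m σ))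
    hd).trans ?_
  rw [coeff_sub, map_sub, hε, hε, sub_self]

lemma barComplex_d_barContract_zero (c : C) (z : Lin c (chainFam C 0))
    (hz : eps c (chainFam C 0) z = 0) :
    ev ((barComplex C).d 1 0) c (barContract 0 c z) = z := by
  refine (ev_barComplex_d 0 c _).trans ?_
  rw [Fin.sum_univ_two, barFace_zero_barContract, barFace_one_barContract, hz, zero_smul,
    smul_zero, add_zero, Fin.val_zero, pow_zero, one_smul]

lemma barComplex_d_barContract (n : ℕ) (c : C) (z : Lin c (chainFam C (n + 1)))
    (hz : ev ((barComplex C).d (n + 1) n) c z = (0 : Lin c (chainFam C n))) :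
    ev ((barComplex C).d (n + 2) (n + 1)) c (barContract (n + 1) c z) = z := by
  have h := congrArg (barContract n c) ((ev_barComplex_d n c z).symm.trans hz)
  refine (ev_barComplex_d (n + 1) c _).trans ?_
  rw [Fin.sum_univ_succ, barFace_zero_barContract]
  simp only [map_sum, map_zsmul, map_zero] at h
  simp only [barFace_succ_barContract, Fin.val_succ, pow_succ, mul_neg, mul_one, neg_smul,
    Finset.sum_neg_distrib, Fin.val_zero, pow_zero, one_smul]
  rw [h, neg_zero, add_zero]

variable (C) in
lemma isResolution_barComplex : IsResolution (barComplex C) where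
  exists_eps_eq_one c := ⟨chainBas (ComposableArrows.mk₀ c) (𝟙 c), eps_bas _ _⟩
  eps_d σ := eps_barComplex_d σ
  exact_zero c z hz := ⟨barContract 0 c z, barComplex_d_barContract_zero c z hz⟩
  exact_succ n c z hz := ⟨barContract (n + 1) c z, barComplex_d_barContract n c z hz⟩

end Bar

/-! ### Right divisors in trace monoids -/

section Divisors

variable {E : Type u} {I : E → E → Prop}

@[elab_as_elim]
lemma trace_induction {P : TraceMonoid I → Prop} (one : P 1)
    (mul_gen : ∀ x a, P x → P (x * gen I a)) (x : TraceMonoid I) : P x := by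
  suffices h : ∀ (l : FreeMonoid E) (y : TraceMonoid I), P y →
      P (y * PresentedMonoid.mk (TraceRel I) l) from
    PresentedMonoid.inductionOn x fun l => one_mul (PresentedMonoid.mk (TraceRel I) l) ▸ h l 1 one
  intro l
  induction l using FreeMonoid.inductionOn' with
  | one => intro y hy; rwa [map_one, mul_one]
  | of_mul a l ih =>
    intro y hy
    rw [map_mul, ← mul_assoc]
    exact ih _ (mul_gen y a hy)

/-- The length of a trace. -/
def len : TraceMonoid I →* Multiplicative ℕ :=
  PresentedMonoid.lift (fun _ => Multiplicative.ofAdd 1) fun _ _ ⟨a, b, _⟩ => by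
    simp

@[simp]
lemma len_gen (a : E) : len (gen I a) = Multiplicative.ofAdd 1 := PresentedMonoid.lift_of _ _

open Classical in
/-- The effect of right multiplication by `b` on a pair consisting of a trace `x` and of the
partial function which sends `a` to the right quotient `x / a`. -/
def quotStep (b : E) (p : TraceMonoid I × (E → Option (TraceMonoid I))) :
    TraceMonoid I × (E → Option (TraceMonoid I)) :=
  (p.1 * gen I b, fun a => if a = b then some p.1 else
    if I a b then (p.2 a).map (· * gen I b) else none)

lemma quotStep_comm (hI : IsIndependence I) {b c : E} (h : I b c)
    (p : TraceMonoid I × (E → Option (TraceMonoid I))) :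
    quotStep c (quotStep b p) = quotStep b (quotStep c p) := by
  have hc := hI.symm _ _ h
  have hbc : b ≠ c := by rintro rfl; exact hI.irrefl _ h
  refine Prod.ext ?_ (funext fun a => ?_)
  · simp only [quotStep, mul_assoc, gen_comm h]
  · by_cases hab : a = b
    · subst hab; simp [quotStep, h, hbc]
    · by_cases hac : a = c
      · subst hac; simp [quotStep, hc, hab]
      · by_cases h1 : I a b <;> by_cases h2 : I a c <;>
          simp [quotStep, hab, hac, h1, h2, Function.comp_def, mul_assoc, gen_comm h]

/-- The monoid `M(E, I)` acts on the right on the pairs of `quotStep`. -/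
def quotHom (hI : IsIndependence I) :
    TraceMonoid I →* (Function.End (TraceMonoid I × (E → Option (TraceMonoid I))))ᵐᵒᵖ :=
  PresentedMonoid.lift (M := (Function.End (TraceMonoid I × (E → Option (TraceMonoid I))))ᵐᵒᵖ)
      (fun b => MulOpposite.op (quotStep b)) fun _ _ ⟨a, b, h⟩ => by
    simp only [map_mul, FreeMonoid.lift_eval_of]
    exact congrArg MulOpposite.op (funext fun p => quotStep_comm hI h p)

/-- The pair consisting of `x` and of the partial function `a ↦ x / a`. -/
def quotPair (hI : IsIndependence I) (x : TraceMonoid I) :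
    TraceMonoid I × (E → Option (TraceMonoid I)) :=
  (quotHom hI x).unop (1, fun _ => none)

lemma quotPair_one (hI : IsIndependence I) : quotPair hI 1 = (1, fun _ => none) := by
  simp [quotPair, Function.End.one_def]

lemma quotPair_mul_gen (hI : IsIndependence I) (x : TraceMonoid I) (a : E) :
    quotPair hI (x * gen I a) = quotStep a (quotPair hI x) := by
  rw [quotPair, map_mul, quotHom, PresentedMonoid.lift_of]
  rfl

lemma quotPair_fst (hI : IsIndependence I) (x : TraceMonoid I) : (quotPair hI x).1 = x := by
  induction x using trace_induction with
  | one => rw [quotPair_one]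
  | mul_gen x a h => rw [quotPair_mul_gen, quotStep, h]

/-- The right quotient `x / a`, if `a` divides `x` on the right. -/
def rquot (hI : IsIndependence I) (x : TraceMonoid I) (a : E) : Option (TraceMonoid I) :=
  (quotPair hI x).2 a

open Classical in
lemma rquot_mul_gen (hI : IsIndependence I) (x : TraceMonoid I) (a b : E) :
    rquot hI (x * gen I b) a = if a = b then some x else
      if I a b then (rquot hI x a).map (· * gen I b) else none := by
  rw [rquot, quotPair_mul_gen, quotStep, quotPair_fst]
  rfl

lemma rquot_eq_some (hI : IsIndependence I) {x y : TraceMonoid I} {a : E} :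
    rquot hI x a = some y ↔ x = y * gen I a := by
  refine ⟨fun h => ?_, fun h => by rw [h, rquot_mul_gen, if_pos rfl]⟩
  induction x using trace_induction generalizing y with
  | one => simp [rquot, quotPair_one] at h
  | mul_gen x b ih =>
    rw [rquot_mul_gen] at h
    split_ifs at h with hab hI'
    · rw [Option.some.inj h, hab]
    · obtain ⟨z, hz, rfl⟩ := Option.map_eq_some_iff.1 h
      rw [ih hz, mul_assoc, mul_assoc, gen_comm hI']

/-- Right cancellation in trace monoids. -/
lemma mul_gen_cancel (hI : IsIndependence I) {x y : TraceMonoid I} {a : E}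
    (h : x * gen I a = y * gen I a) : x = y := by
  have := (rquot_eq_some hI).2 h
  rw [rquot_mul_gen, if_pos rfl] at this
  exact Option.some.inj this

/-- Two distinct right divisors of a trace are independent and their product is a right divisor. -/
lemma mul_gen_eq_mul_gen (hI : IsIndependence I) {x y : TraceMonoid I} {a b : E} (hab : a ≠ b)
    (h : x * gen I a = y * gen I b) :
    I a b ∧ ∃ z, x = z * gen I b ∧ y = z * gen I a := by
  have := (rquot_eq_some hI).2 h
  rw [rquot_mul_gen, if_neg hab.symm] at this
  split_ifs at this with hI'
  obtain ⟨z, hz, rfl⟩ := Option.map_eq_some_iff.1 this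
  exact ⟨hI.symm _ _ hI', z, (rquot_eq_some hI).1 hz, rfl⟩

end Divisors

/-! ### The cubical resolution -/

section CubeResolution

variable {E : Type u} {I : E → E → Prop} [LinearOrder E] {S : Type v}

/-- The sequence `m < a₁ < ⋯ < aₙ`. -/
def Torus.cons {n : ℕ} (a : Torus I n) (m : E) (h : ∀ i, m < a.1 i ∧ I m (a.1 i)) :
    Torus I (n + 1) :=
  ⟨Fin.cons m a.1, fun i j hij => by
    cases j using Fin.cases with
    | zero => exact absurd hij (Fin.not_lt_zero i)
    | succ j =>
      cases i using Fin.cases with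
      | zero => simpa using h j
      | succ i => simpa using a.2 i j (Fin.succ_lt_succ_iff.1 hij)⟩

lemma Torus.erase_zero_cons {n : ℕ} (a : Torus I n) (m : E) (h) : (a.cons m h).erase 0 = a :=
  Subtype.ext (funext fun i => by simp [cons, erase])

lemma Torus.erase_succ_cons {n : ℕ} (a : Torus I (n + 1)) (m : E) (h) (s : Fin (n + 1)) :
    (a.cons m h).erase s.succ = (a.erase s).cons m fun i => h (s.succAbove i) :=
  Subtype.ext (funext fun i => by cases i using Fin.cases <;> simp [cons, erase])

lemma Torus.cons_head_erase {n : ℕ} (a : Torus I (n + 1)) (h) :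
    (a.erase 0).cons (a.1 0) h = a :=
  Subtype.ext (funext fun i => by cases i using Fin.cases <;> simp [cons, erase])

variable (A : PartialAction (TraceMonoid I) S)

/-- The family of the bases of the `n`-cubes. -/
abbrev cubeFam (n : ℕ) : FreeFam.{v, max u v} (AugState A) := ⟨Cube A n, Cube.base⟩

/-- The difference of the two faces of a cube in the direction with index `s`. -/
def cubeFamFace (n : ℕ) (s : Fin (n + 1)) : cubeFam A (n + 1) ⟶ cubeFam A n :=
  homMk fun q => bas (cubeFam A n) (q.face₁ s) (step A q.base (gen I (q.dirs.1 s))) -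
    bas (cubeFam A n) (q.face₀ s) (𝟙 q.base)

/-- The differential of the cubical complex of free families. -/
def cubeFamD (n : ℕ) : cubeFam A (n + 1) ⟶ cubeFam A n :=
  ∑ s : Fin (n + 1), (-1 : ℤ) ^ ((s : ℕ) + 1) • cubeFamFace A n s

variable {A}

lemma realizeMap_cubeFamFace (F : AugState A ⥤ AddCommGrpCat.{w}) (n : ℕ) (s : Fin (n + 1)) :
    realizeMap F (cubeFamFace A n s) = cubeFace F n s :=
  hom_ext fun q a => by
    refine (realizeMap_push F (cubeFamFace A n s) q (𝟙 _) a).trans ?_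
    refine Eq.trans ?_ (glue_push F _ _ q (𝟙 _) a).symm
    rw [cubeFamFace, coeff_homMk, map_sub, act_bas, act_bas]

lemma realizeMap_cubeFamD (F : AugState A ⥤ AddCommGrpCat.{w}) (n : ℕ) :
    realizeMap F (cubeFamD A n) = cubeD F n := by
  refine (map_sum (realizeHom F (cubeFam A (n + 1)) (cubeFam A n)) _ _).trans
    (Finset.sum_congr rfl fun s _ => ?_)
  rw [map_zsmul]
  exact congrArg _ (realizeMap_cubeFamFace F n s)

lemma cubeFamD_comp (n : ℕ) : cubeFamD A (n + 1) ≫ cubeFamD A n = 0 :=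
  eq_of_realizeMap_eq fun F => by
    rw [realizeMap_comp, realizeMap_cubeFamD, realizeMap_cubeFamD, cubeD_squared]
    exact (map_zero (realizeHom F (cubeFam A (n + 2)) (cubeFam A n))).symm

variable (A) in
/-- The cubical complex of free families. -/
def cubeFamComplex : ChainComplex (FreeFam.{v, max u v} (AugState A)) ℕ :=
  ChainComplex.of (cubeFam A) (cubeFamD A) cubeFamD_comp

lemma cubeFamComplex_d (n : ℕ) : (cubeFamComplex A).d (n + 1) n = cubeFamD A n :=
  ChainComplex.of_d _ _ _

/-- Realizing the cubical complex of free families gives the cubical complex. -/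
def realizeCubeFamComplexIso (F : AugState A ⥤ AddCommGrpCat.{w}) :
    ((realize F).mapHomologicalComplex _).obj (cubeFamComplex A) ≅ cubeComplex F :=
  HomologicalComplex.Hom.isoOfComponents (fun _ => Iso.refl _) fun i j (hij : j + 1 = i) => by
    subst hij
    refine (Category.id_comp _).trans (Eq.trans ?_ (Category.comp_id _).symm)
    refine (ChainComplex.of_d (fun n => AddCommGrpCat.of (CubeChains F n))
      (fun n => AddCommGrpCat.ofHom (cubeD F n)) j).trans ?_
    refine Eq.trans ?_ (congrArg (realize F).map (cubeFamComplex_d j)).symm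
    exact congrArg AddCommGrpCat.ofHom (realizeMap_cubeFamD F j).symm

variable {c : AugState A}

variable (c) in
/-- The basis element given by the arrow `w` out of `c` and by the cube with base `c · w` and
directions `a`. -/
def cell {n : ℕ} (w : TraceMonoid I) (a : Torus I n) : Lin c (cubeFam A n) :=
  bas (cubeFam A n) ⟨A.aug c w, a⟩ (step A c w)

lemma bas_cubeFam {n : ℕ} (q : Cube A n) (f : c ⟶ q.base) :
    bas (cubeFam A n) q f = cell c f.1 q.dirs := by
  obtain ⟨w, hw⟩ := f
  obtain ⟨x, a⟩ := q
  obtain rfl : A.aug c w = x := hw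
  rfl

lemma cell_hom_ext {n : ℕ} {B : Type*} [AddCommGroup B] {φ ψ : Lin c (cubeFam A n) →+ B}
    (h : ∀ w a, φ (cell c w a) = ψ (cell c w a)) : φ = ψ :=
  lin_hom_ext fun q f => by rw [bas_cubeFam, h]

/-- The homomorphism with prescribed values on the cells. -/
def cellLift {n : ℕ} {B : Type*} [AddCommGroup B] (φ : TraceMonoid I → Torus I n → B) :
    Lin c (cubeFam A n) →+ B :=
  linLift fun q f => φ f.1 q.dirs

@[simp]
lemma cellLift_cell {n : ℕ} {B : Type*} [AddCommGroup B] (φ : TraceMonoid I → Torus I n → B)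
    (w : TraceMonoid I) (a : Torus I n) : cellLift φ (cell c w a) = φ w a := linLift_bas _ _ _

variable (c) in
/-- The part of the differential formed by the upper faces; it preserves the product of the trace
with the directions. -/
def topD (n : ℕ) : Lin c (cubeFam A (n + 1)) →+ Lin c (cubeFam A n) :=
  cellLift fun w a => ∑ s : Fin (n + 1), (-1 : ℤ) ^ ((s : ℕ) + 1) •
    cell c (w * gen I (a.1 s)) (a.erase s)

variable (c) in
/-- The part of the differential formed by the lower faces. -/
def botD (n : ℕ) : Lin c (cubeFam A (n + 1)) →+ Lin c (cubeFam A n) :=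
  cellLift fun w a => ∑ s : Fin (n + 1), (-1 : ℤ) ^ ((s : ℕ) + 1) • cell c w (a.erase s)

lemma ev_cubeFamFace_cell {n : ℕ} (s : Fin (n + 1)) (w : TraceMonoid I) (a : Torus I (n + 1)) :
    ev (cubeFamFace A n s) c (cell c w a) =
      cell c (w * gen I (a.1 s)) (a.erase s) - cell c w (a.erase s) := by
  rw [cell, ev_bas, cubeFamFace, coeff_homMk, map_sub, pre_bas, pre_bas, bas_cubeFam, bas_cubeFam,
    Category.comp_id]
  rfl

lemma ev_cubeFamD (n : ℕ) (z : Lin c (cubeFam A (n + 1))) :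
    ev (cubeFamD A n) c z = topD c n z - botD c n z := by
  refine DFunLike.congr_fun (f := ev (cubeFamD A n) c) (g := topD c n - botD c n)
    (cell_hom_ext fun w a => ?_) z
  have h : ev (cubeFamD A n) c =
      ∑ s : Fin (n + 1), (-1 : ℤ) ^ ((s : ℕ) + 1) • ev (cubeFamFace A n s) c := by
    refine (map_sum (evHom (cubeFam A (n + 1)) (cubeFam A n) c) _ _).trans
      (Finset.sum_congr rfl fun s _ => ?_)
    rw [map_zsmul]
    rfl
  rw [h, AddMonoidHom.sub_apply, topD, botD, cellLift_cell, cellLift_cell,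
    AddMonoidHom.finsetSum_apply, ← Finset.sum_sub_distrib]
  exact Finset.sum_congr rfl fun s _ => by
    rw [AddMonoidHom.zsmul_apply, ev_cubeFamFace_cell, smul_sub]

/-- `m` is the least generator which divides `w` on the right, precedes `a₁, …, aₙ` and is
independent of them; and `w = w' m`. -/
structure IsPivot {n : ℕ} (w : TraceMonoid I) (a : Torus I n) (m : E) (w' : TraceMonoid I) :
    Prop where
  eq : w = w' * gen I m
  lt : ∀ i, m < a.1 i ∧ I m (a.1 i)
  le : ∀ b y, w = y * gen I b → (∀ i, b < a.1 i ∧ I b (a.1 i)) → m ≤ b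

lemma IsPivot.unique (hI : IsIndependence I) {n : ℕ} {w : TraceMonoid I} {a : Torus I n} {m m' : E}
    {w' w'' : TraceMonoid I} (h : IsPivot w a m w') (h' : IsPivot w a m' w'') :
    m = m' ∧ w' = w'' := by
  obtain rfl : m = m' := le_antisymm (h.le _ _ h'.eq h'.lt) (h'.le _ _ h.eq h.lt)
  exact ⟨rfl, mul_gen_cancel hI (h.eq.symm.trans h'.eq)⟩

/-- A pivot exists if there is a candidate, since the right divisors of a trace are pairwise
independent, hence finite in number. -/
lemma exists_isPivot (hI : IsIndependence I)
    (hfin : ∀ B : Set E, (∀ a ∈ B, ∀ b ∈ B, a ≠ b → I a b) → B.Finite) {n : ℕ}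
    {w : TraceMonoid I} {a : Torus I n} {b : E} {y : TraceMonoid I} (hw : w = y * gen I b)
    (hb : ∀ i, b < a.1 i ∧ I b (a.1 i)) : ∃ m w', IsPivot w a m w' := by
  have hB : {b | (∃ y, w = y * gen I b) ∧ ∀ i, b < a.1 i ∧ I b (a.1 i)}.Finite :=
    hfin _ fun b ⟨⟨y, hy⟩, _⟩ b' ⟨⟨y', hy'⟩, _⟩ hne =>
      (mul_gen_eq_mul_gen hI hne (hy.symm.trans hy')).1
  obtain ⟨m, ⟨⟨w', hw'⟩, hm⟩, hmin⟩ := Set.exists_min_image _ id hB ⟨b, ⟨y, hw⟩, hb⟩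
  exact ⟨m, w', hw', hm, fun b y hy hb => hmin b ⟨⟨y, hy⟩, hb⟩⟩

/-- A candidate for the pivot of an upper face, if distinct from the omitted direction, is a
candidate for the pivot of the cell. -/
lemma candidate_of_erase (hI : IsIndependence I) {n : ℕ} {w : TraceMonoid I} {a : Torus I (n + 1)}
    {s : Fin (n + 1)} {b : E} {y : TraceMonoid I} (hw : w * gen I (a.1 s) = y * gen I b)
    (hb : ∀ i, b < (a.erase s).1 i ∧ I b ((a.erase s).1 i)) (hbs : b < a.1 s) :
    (∃ z, w = z * gen I b) ∧ ∀ i, b < a.1 i ∧ I b (a.1 i) := by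
  obtain ⟨h, z, hz, -⟩ := mul_gen_eq_mul_gen hI hbs.ne' hw
  refine ⟨⟨z, hz⟩, fun i => ?_⟩
  obtain rfl | ⟨j, rfl⟩ := Fin.eq_self_or_eq_succAbove s i
  · exact ⟨hbs, hI.symm _ _ h⟩
  · exact hb j

lemma IsPivot.erase (hI : IsIndependence I) {n : ℕ} {w : TraceMonoid I} {a : Torus I (n + 1)}
    {m : E} {w' : TraceMonoid I} (h : IsPivot w a m w') (s : Fin (n + 1)) :
    IsPivot (w * gen I (a.1 s)) (a.erase s) m (w' * gen I (a.1 s)) where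
  eq := by rw [h.eq, mul_assoc, mul_assoc, gen_comm (h.lt s).2]
  lt i := h.lt _
  le b y hy hb := by
    by_contra! hlt
    obtain ⟨⟨z, hz⟩, hb'⟩ := candidate_of_erase hI hy hb (hlt.trans (h.lt s).1)
    exact hlt.not_ge (h.le b z hz hb')

lemma isPivot_erase_zero (hI : IsIndependence I) {n : ℕ} {w : TraceMonoid I} {a : Torus I (n + 1)}
    (h : ∀ b y, w = y * gen I b → ¬ ∀ i, b < a.1 i ∧ I b (a.1 i)) :
    IsPivot (w * gen I (a.1 0)) (a.erase 0) (a.1 0) w where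
  eq := rfl
  lt i := a.2 0 _ (by simp)
  le b y hy hb := by
    by_contra! hlt
    obtain ⟨⟨z, hz⟩, hb'⟩ := candidate_of_erase hI hy hb hlt
    exact h b z hz hb'

lemma not_isPivot_erase_succ (hI : IsIndependence I) {n : ℕ} {w : TraceMonoid I}
    {a : Torus I (n + 1)} (h : ∀ b y, w = y * gen I b → ¬ ∀ i, b < a.1 i ∧ I b (a.1 i))
    (s : Fin (n + 1)) (hs : s ≠ 0) (m : E) (w' : TraceMonoid I) :
    ¬ IsPivot (w * gen I (a.1 s)) (a.erase s) m w' := fun hp => by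
  -- The first direction `a₁` is kept by the face, so that `m < a₁ < aₛ`.
  obtain ⟨j, hj⟩ := Fin.exists_succAbove_eq hs.symm
  have h0 : m < a.1 0 := by simpa [Torus.erase, hj] using (hp.lt j).1
  obtain ⟨⟨z, hz⟩, hb⟩ := candidate_of_erase hI hp.eq hp.lt
    (h0.trans (a.2 0 s (Fin.pos_of_ne_zero hs)).1)
  exact h m z hz hb

open Classical in
variable (c) in
/-- The contraction for the upper part of the differential: `(w' m; a₁, …, aₙ)` is sent to
`-(w'; m, a₁, …, aₙ)` if `m` is the pivot, and to zero if there is no pivot. -/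
def cubeContract (n : ℕ) : Lin c (cubeFam A n) →+ Lin c (cubeFam A (n + 1)) :=
  cellLift fun w a => if H : ∃ p : E × TraceMonoid I, IsPivot w a p.1 p.2 then
    -cell c H.choose.2 (a.cons H.choose.1 H.choose_spec.lt) else 0

lemma cubeContract_of_isPivot (hI : IsIndependence I) {n : ℕ} {w : TraceMonoid I} {a : Torus I n}
    {m : E} {w' : TraceMonoid I} (h : IsPivot w a m w') :
    cubeContract c n (cell c w a) = -cell c w' (a.cons m h.lt) := by
  have H : ∃ p : E × TraceMonoid I, IsPivot w a p.1 p.2 := ⟨(m, w'), h⟩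
  obtain ⟨h1, h2⟩ := h.unique hI H.choose_spec
  rw [cubeContract, cellLift_cell, dif_pos H]
  simp only [h1, h2]

lemma cubeContract_of_not_isPivot {n : ℕ} {w : TraceMonoid I} {a : Torus I n}
    (h : ∀ m w', ¬ IsPivot w a m w') : cubeContract c n (cell c w a) = 0 := by
  rw [cubeContract, cellLift_cell, dif_neg]
  rintro ⟨p, hp⟩
  exact h _ _ hp

/-- In positive degrees, the upper part of the differential is contractible. -/
lemma topD_cubeContract_add (hI : IsIndependence I)
    (hfin : ∀ B : Set E, (∀ a ∈ B, ∀ b ∈ B, a ≠ b → I a b) → B.Finite) (n : ℕ)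
    (z : Lin c (cubeFam A (n + 1))) :
    topD c (n + 1) (cubeContract c (n + 1) z) + cubeContract c n (topD c n z) = z := by
  refine DFunLike.congr_fun (f := (topD c (n + 1)).comp (cubeContract c (n + 1)) +
    (cubeContract c n).comp (topD c n)) (g := AddMonoidHom.id _) (cell_hom_ext fun w a => ?_) z
  simp only [AddMonoidHom.add_apply, AddMonoidHom.comp_apply, AddMonoidHom.id_apply]
  have ht : cubeContract c n (topD c n (cell c w a)) = ∑ s : Fin (n + 1), (-1 : ℤ) ^ ((s : ℕ) + 1) •
      cubeContract c n (cell c (w * gen I (a.1 s)) (a.erase s)) := by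
    rw [topD, cellLift_cell, map_sum]
    simp only [map_zsmul]
  by_cases H : ∃ m w', IsPivot w a m w'
  -- The pivot `m` of a cell is the pivot of all its upper faces, and the upper face of
  -- `-(w'; m, a₁, …, aₙ)` which omits `m` is the given cell.
  · obtain ⟨m, w', h⟩ := H
    have h' (s) := cubeContract_of_isPivot (c := c) hI (h.erase hI s)
    rw [ht, cubeContract_of_isPivot hI h, map_neg, topD, cellLift_cell, Fin.sum_univ_succ]
    simp only [h', Torus.erase_zero_cons, Torus.erase_succ_cons]
    simp [Torus.cons, ← h.eq, pow_succ]
  -- Without a pivot, only the face which omits `a₁` has a pivot, namely `a₁`.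
  · have hb : ∀ b y, w = y * gen I b → ¬ ∀ i, b < a.1 i ∧ I b (a.1 i) := fun b y hw hb =>
      H (exists_isPivot hI hfin hw hb)
    rw [ht, cubeContract_of_not_isPivot fun m w' h => H ⟨m, w', h⟩, map_zero, zero_add,
      Fin.sum_univ_succ, cubeContract_of_isPivot hI (isPivot_erase_zero hI hb),
      Torus.cons_head_erase, Finset.sum_eq_zero fun s _ => ?_]
    · simp
    · rw [cubeContract_of_not_isPivot (not_isPivot_erase_succ hI hb _ (Fin.succ_ne_zero s)),
        smul_zero]

variable (c) in
/-- The span of the cells `(w; a₁, …, aₙ)` such that the length of `w a₁ ⋯ aₙ` is less than `k`. -/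
def lowSpan (n k : ℕ) : AddSubgroup (Lin c (cubeFam A n)) :=
  AddSubgroup.closure {z | ∃ w a, (len w).toAdd + n < k ∧ z = cell c w a}

lemma cell_mem_lowSpan {n k : ℕ} {w : TraceMonoid I} (a : Torus I n)
    (h : (len w).toAdd + n < k) : cell c w a ∈ lowSpan c n k :=
  AddSubgroup.subset_closure ⟨w, a, h, rfl⟩

lemma map_mem_of_mem_lowSpan {n k : ℕ} {B : Type*} [AddCommGroup B] (φ : Lin c (cubeFam A n) →+ B)
    (V : AddSubgroup B) (h : ∀ w a, (len w).toAdd + n < k → φ (cell c w a) ∈ V)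
    {z : Lin c (cubeFam A n)} (hz : z ∈ lowSpan c n k) : φ z ∈ V := by
  refine (AddSubgroup.closure_le (K := V.comap φ)).2 ?_ hz
  rintro _ ⟨w, a, hwa, rfl⟩
  exact h w a hwa

lemma exists_mem_lowSpan {n : ℕ} (z : Lin c (cubeFam A n)) : ∃ k, z ∈ lowSpan c n k := by
  have hmono {k l : ℕ} (h : k ≤ l) {z : Lin c (cubeFam A n)} (hz : z ∈ lowSpan c n k) :
      z ∈ lowSpan c n l :=
    map_mem_of_mem_lowSpan (AddMonoidHom.id _) _ (fun w a hw => cell_mem_lowSpan a (hw.trans_le h))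
      hz
  induction z using Finsupp.induction_linear with
  | zero => exact ⟨0, zero_mem _⟩
  | add x y hx hy =>
    obtain ⟨k, hk⟩ := hx
    obtain ⟨l, hl⟩ := hy
    exact ⟨max k l, add_mem (hmono (le_max_left k l) hk) (hmono (le_max_right k l) hl)⟩
  | single p r =>
    have hp : Finsupp.single p r = r • cell c p.2.1 p.1.dirs := by
      rw [← bas_cubeFam]; simp [bas]
    exact ⟨_, hp ▸ zsmul_mem (cell_mem_lowSpan _ (Nat.lt_succ_self _)) r⟩

lemma cubeContract_mem_lowSpan (hI : IsIndependence I) {n k : ℕ} {z : Lin c (cubeFam A n)}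
    (hz : z ∈ lowSpan c n k) : cubeContract c n z ∈ lowSpan c (n + 1) k := by
  refine map_mem_of_mem_lowSpan _ _ (fun w a hw => ?_) hz
  by_cases H : ∃ m w', IsPivot w a m w'
  · obtain ⟨m, w', h⟩ := H
    rw [cubeContract_of_isPivot hI h]
    refine neg_mem (cell_mem_lowSpan _ ?_)
    rw [h.eq, map_mul, len_gen, toAdd_mul, toAdd_ofAdd] at hw
    omega
  · rw [cubeContract_of_not_isPivot fun m w' h => H ⟨m, w', h⟩]
    exact zero_mem _

lemma botD_mem_lowSpan {n k : ℕ} {z : Lin c (cubeFam A (n + 1))}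
    (hz : z ∈ lowSpan c (n + 1) (k + 1)) : botD c n z ∈ lowSpan c n k := by
  refine map_mem_of_mem_lowSpan _ _ (fun w a hw => ?_) hz
  rw [botD, cellLift_cell]
  exact sum_mem fun s _ => zsmul_mem (cell_mem_lowSpan _ (by omega)) _

/-- The cubical complex is exact in positive degrees: modulo a boundary, a cycle can be moved to
cells of smaller length. -/
lemma exists_cubeFamD_eq (hI : IsIndependence I)
    (hfin : ∀ B : Set E, (∀ a ∈ B, ∀ b ∈ B, a ≠ b → I a b) → B.Finite) {n : ℕ} (k : ℕ)
    (z : Lin c (cubeFam A (n + 1))) (hk : z ∈ lowSpan c (n + 1) k)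
    (hz : ev (cubeFamD A n) c z = 0) : ∃ y, ev (cubeFamD A (n + 1)) c y = z := by
  induction k generalizing z with
  | zero =>
    refine ⟨0, (map_zero _).trans ?_⟩
    have := map_mem_of_mem_lowSpan (AddMonoidHom.id _) ⊥ (fun w a hw => absurd hw (by omega)) hk
    exact (AddSubgroup.mem_bot.1 this).symm
  | succ k ih =>
    have h1 := topD_cubeContract_add hI hfin n z
    -- Since `z` is a cycle, subtracting the boundary of its contraction leaves only terms which
    -- contain a lower face.
    have h2 : topD c n z = botD c n z := by rwa [ev_cubeFamD, sub_eq_zero] at hz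
    have h3 : z - ev (cubeFamD A (n + 1)) c (cubeContract c (n + 1) z) =
        cubeContract c n (botD c n z) + botD c (n + 1) (cubeContract c (n + 1) z) := by
      rw [ev_cubeFamD, ← h2]
      nth_rewrite 1 [← h1]
      abel
    obtain ⟨y, hy⟩ := ih (z - ev (cubeFamD A (n + 1)) c (cubeContract c (n + 1) z))
      (h3 ▸ add_mem (cubeContract_mem_lowSpan hI (botD_mem_lowSpan hk))
        (botD_mem_lowSpan (cubeContract_mem_lowSpan hI hk))) (by
        rw [map_sub, hz, ← ev_comp, cubeFamD_comp, zero_sub, neg_eq_zero]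
        exact DFunLike.congr_fun (map_zero (evHom (cubeFam A (n + 2)) (cubeFam A n) c)) _)
    exact ⟨y + cubeContract c (n + 1) z, by rw [map_add, hy, sub_add_cancel]⟩

/-- Every vertex is homologous to the vertex `(1; )`. -/
lemma exists_cubeFamD_zero_eq (a : Torus I 0) (w : TraceMonoid I) :
    ∃ y, ev (cubeFamD A 0) c y = cell c w a - cell c 1 a := by
  induction w using trace_induction with
  | one => exact ⟨0, by rw [map_zero, sub_self]⟩
  | mul_gen w b ih =>
    obtain ⟨y, hy⟩ := ih
    refine ⟨y - cell c w (a.cons b fun i => i.elim0), ?_⟩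
    rw [map_sub, hy, ev_cubeFamD, topD, botD, cellLift_cell, cellLift_cell, Fin.sum_univ_one,
      Fin.sum_univ_one, Torus.erase_zero_cons]
    simp only [Torus.cons, Fin.cons_zero, Fin.val_zero, zero_add, pow_one, neg_smul, one_smul]
    abel

lemma exists_cubeFamD_zero_eq_of_eps (a : Torus I 0) (z : Lin c (cubeFam A 0)) :
    ∃ y, ev (cubeFamD A 0) c y = z - eps c (cubeFam A 0) z • cell c 1 a := by
  induction z using Finsupp.induction_linear with
  | zero => exact ⟨0, by simp⟩
  | add x y hx hy =>
    obtain ⟨x', hx'⟩ := hx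
    obtain ⟨y', hy'⟩ := hy
    exact ⟨x' + y', by rw [map_add, hx', hy', map_add, add_smul]; abel⟩
  | single p r =>
    obtain rfl : p.1.dirs = a := Subtype.ext (funext fun i => i.elim0)
    obtain ⟨y, hy⟩ := exists_cubeFamD_zero_eq (c := c) p.1.dirs p.2.1
    have hp : Finsupp.single p r = r • cell c p.2.1 p.1.dirs := by
      rw [← bas_cubeFam]; simp [bas]
    refine ⟨r • y, ?_⟩
    rw [map_zsmul, hy, hp, map_zsmul, ← bas_cubeFam, eps_bas, smul_sub, smul_eq_mul, mul_one]

lemma eps_cubeFamD (q : Cube A 1) : eps q.base (cubeFam A 0) (coeff (cubeFamD A 0) q) = 0 := by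
  have h : cubeFamD A 0 = 0 - cubeFamFace A 0 0 := by
    refine (Fin.sum_univ_one _).trans ?_
    simp
  rw [h, coeff_sub, coeff_zero, cubeFamFace, coeff_homMk, map_sub, map_sub, eps_bas, eps_bas,
    map_zero, sub_self, sub_zero]

lemma isResolution_cubeFamComplex (hI : IsIndependence I)
    (hfin : ∀ B : Set E, (∀ a ∈ B, ∀ b ∈ B, a ≠ b → I a b) → B.Finite) :
    IsResolution (cubeFamComplex A) where
  exists_eps_eq_one c := ⟨cell c 1 ⟨fun i => i.elim0, fun i => i.elim0⟩, eps_bas _ _⟩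
  eps_d q := (congrArg (fun m : cubeFam A 1 ⟶ cubeFam A 0 => eps _ (cubeFam A 0) (coeff m q))
    (cubeFamComplex_d 0)).trans (eps_cubeFamD q)
  exact_zero c := by
    intro (z : Lin c (cubeFam A 0)) (hz : eps c (cubeFam A 0) z = 0)
    obtain ⟨y, hy⟩ := exists_cubeFamD_zero_eq_of_eps ⟨fun i => i.elim0, fun i => i.elim0⟩ z
    rw [cubeFamComplex_d]
    exact ⟨y, hy.trans (by rw [hz, zero_smul, sub_zero])⟩
  exact_succ n c z hz := by
    obtain ⟨k, hk⟩ := exists_mem_lowSpan z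
    rw [cubeFamComplex_d] at hz
    rw [cubeFamComplex_d]
    exact exists_cubeFamD_eq hI hfin k z hk hz

end CubeResolution

end TraceHomology

end

theorem mainTheorem3 {E : Type u} [LinearOrder E] (I : E → E → Prop)
    (hI : TraceHomology.IsIndependence I)
    (hfin : ∀ B : Set E, (∀ a ∈ B, ∀ b ∈ B, a ≠ b → I a b) → B.Finite)
    {S : Type v} (A : TraceHomology.PartialAction (TraceHomology.TraceMonoid I) S)
    (F : TraceHomology.AugState A ⥤ AddCommGrpCat.{w}) (n : ℕ) :
    Nonempty (TraceHomology.categoryHomology F n ≅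
      (TraceHomology.cubeComplex F).homology n) := by
  obtain ⟨e⟩ := TraceHomology.nonempty_homology_iso (TraceHomology.isResolution_barComplex _)
    (TraceHomology.isResolution_cubeFamComplex (A := A) hI hfin) F n
  exact ⟨((HomologicalComplex.homologyFunctor _ _ n).mapIso
    (TraceHomology.realizeBarComplexIso F)).symm ≪≫ e ≪≫
    (HomologicalComplex.homologyFunctor _ _ n).mapIso
      (TraceHomology.realizeCubeFamComplexIso F)⟩
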